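/- Let $H=(V,E)$ be a directed hypergraph on a finite vertex set $V$ with $|V|=n\ge 2$: each edge $e\in E$ is a subset of $V$ partitioned into a nonempty tail $T_e$ and a nonempty head $H_e$, and distinct edges have distinct vertex sets. Suppose that $H$ is $m$-uniform ($m\ge 1$), i.e. $|e|=|T_e|+|H_e|=m$ for every $e\in E$. The out-degree of $v\in V$ is $d_v^+=|\{e\in E: v\in T_e\}|$; let $\delta^+$ and $\Delta^+$ be the smallest and the highest out-degree, and let $v_1,\dots,v_n$ be an enumeration of $V$ whose out-degrees $d_i^+=d_{v_i}^+$ satisfy $$\delta^+=d_1^+\le d_2^+\le\dots\le d_{n-1}^+\le d_n^+=\Delta^+ .$$ The out-adjacency hypermatrix $A_H^+=(a^+_{i_1\dots i_m})$ of order $m$ and dimension $n$ has the entry $$a^+_{i_1\dots i_m}=\frac{1}{(m-k)!\,(k-1)!}$$ if there is an edge $e$ with $|T_e|=k$ such that $i_1,\dots,i_m$ are distinct, $T_e=\{v_{i_1},\dots,v_{i_k}\}$ and $H_e=\{v_{i_{k+1}},\dots,v_{i_m}\}$, and all its other entries are $0$. A number $\lambda\in\mathbb{C}$ is an eigenvalue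 of a real hypermatrix $A=(a_{i_1\dots i_m})$ if there is $x\in\mathbb{C}^n\setminus\{0\}$ with $$\sum_{i_2,\dots,i_m=1}^n a_{i i_2\dots i_m}x_{i_2}\cdots x_{i_m}=\lambda x_i^{m-1}\qquad (i=1,\dots,n),$$ and $\rho(A)$ denotes the largest modulus of an eigenvalue of $A$. Then the maximum defining $\rho(A_H^+)$ exists, and $$(\delta^+)^{\frac1m}\,(d_2^+)^{1-\frac1m}\;\le\;\rho(A_H^+)\;\le\;(\Delta^+)^{\frac1m}\,(d_{n-1}^+)^{1-\frac1m}.$$ -/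

import Mathlib

/-- A directed hypergraph on the vertex set `V`. A directed hyperedge is a nonempty set of vertices
partitioned into a nonempty tail and a nonempty head; it is stored as the pair `(tail, head)`.
Distinct edges have distinct underlying vertex sets `tail ∪ head`. -/
structure DirectedHypergraph (V : Type*) [DecidableEq V] where
  /-- the edges, as pairs (tail, head) -/
  edges : Finset (Finset V × Finset V)
  tail_nonempty : ∀ e ∈ edges, e.1.Nonempty
  head_nonempty : ∀ e ∈ edges, e.2.Nonempty
  disjoint : ∀ e ∈ edges, Disjoint e.1 e.2
  union_inj : ∀ e ∈ edges, ∀ f ∈ edges, e.1 ∪ e.2 = f.1 ∪ f.2 → e = f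

/-- A real hypermatrix of order `m` whose indices range over `V`. -/
abbrev Hypermatrix (m : ℕ) (V : Type*) := (Fin m → V) → ℝ

namespace Hypermatrix

variable {m : ℕ} [NeZero m] {V : Type*} [Fintype V] [DecidableEq V]

/-- `(A x^{m-1})_i = ∑_{i₂, …, i_m} a_{i i₂ … i_m} x_{i₂} ⋯ x_{i_m}`: the sum over all multi-indices
`I` whose first entry `I 0` is `i`. -/
noncomputable def apply (A : Hypermatrix m V) (x : V → ℂ) (i : V) : ℂ :=
  ∑ I : Fin m → V with I 0 = i, (A I : ℂ) * ∏ j ∈ Finset.univ.erase (0 : Fin m), x (I j)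

/-- `l` is an eigenvalue of `A`: `A x^{m-1} = l x^{[m-1]}` for some nonzero complex vector `x`. -/
def IsEigenvalue (A : Hypermatrix m V) (l : ℂ) : Prop :=
  ∃ x : V → ℂ, x ≠ 0 ∧ ∀ i, A.apply x i = l * x i ^ (m - 1)

/-- The set of the moduli of the eigenvalues of `A`. -/
def eigenvalueModuli (A : Hypermatrix m V) : Set ℝ :=
  {r | ∃ l : ℂ, A.IsEigenvalue l ∧ r = ‖l‖}

/-- The spectral radius: the largest modulus of an eigenvalue. -/
noncomputable def spectralRadius (A : Hypermatrix m V) : ℝ :=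
  sSup A.eigenvalueModuli

end Hypermatrix

namespace DirectedHypergraph

variable {V : Type*} [DecidableEq V] (H : DirectedHypergraph V)

/-- `H` is `m`-uniform: every edge has exactly `m` vertices. -/
def IsUniform (m : ℕ) : Prop :=
  ∀ e ∈ H.edges, (e.1 ∪ e.2).card = m

/-- The out-degree of `v`: the number of edges whose tail contains `v`. -/
def outDegree (v : V) : ℕ :=
  (H.edges.filter fun e => v ∈ e.1).card

/-- The smallest out-degree. -/
noncomputable def minOutDegree : ℕ := ⨅ v, H.outDegree v

/-- The highest out-degree (used for finite `V` only). -/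
noncomputable def maxOutDegree : ℕ := ⨆ v, H.outDegree v

/-- The multi-index `I = (i₁, …, i_m)` lists the edge `e`: its entries are distinct, the first
`k = |T_e|` of them are exactly the vertices of the tail, and the remaining ones are exactly the
vertices of the head. -/
def ListsEdge {m : ℕ} (I : Fin m → V) (e : Finset V × Finset V) : Prop :=
  Function.Injective I ∧
    (Finset.univ.filter fun j : Fin m => (j : ℕ) < e.1.card).image I = e.1 ∧
    (Finset.univ.filter fun j : Fin m => e.1.card ≤ (j : ℕ)).image I = e.2

open Classical in
/-- The out-adjacency hypermatrix of an `m`-uniform directed hypergraph: the entry at `I` is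
`1 / ((m - k)! (k - 1)!)` if `I` lists an edge with tail length `k`, and `0` if it lists no edge.
(A multi-index lists at most one edge, so the sum has at most one nonzero term.) -/
noncomputable def outAdjacency (m : ℕ) : Hypermatrix m V := fun I =>
  ∑ e ∈ H.edges, if ListsEdge I e then
    1 / (((m - e.1.card).factorial : ℝ) * ((e.1.card - 1).factorial : ℝ)) else 0

end DirectedHypergraph

/-!
Call `μ` a subeigenvalue of a map `f` of the nonnegative cone when `μ x^[p] ≤ f x` for some nonzero
`x` in the cone. A continuous, order-preserving map that is homogeneous of degree `p` has a largest
subeigenvalue, and it is attained at an eigenvector: if `f` is strictly monotone, a maximizer that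
is not an eigenvector could be improved, and the general case follows by perturbation. Taking
absolute values in `A x^{m-1} = l x^[m-1]` then shows that the largest subeigenvalue of a
nonnegative hypermatrix is its spectral radius. Hence every nonzero `x ≥ 0` gives a lower bound, and
every positive `w` with `A w^{m-1} ≤ ν w^[m-1]` gives the upper bound `ν`.

For the out-adjacency hypermatrix, the factorials count the listings of an edge with given first
entry, so `(A x^{m-1})_i` is the sum over the edges `e` with `i` in their tail of the product of `x`
over `e \ {i}`. Both bounds come from a vector equal to `1` except at one vertex of extreme degree.
-/

section PerronFrobenius

open Filter Topology

variable {V : Type*} {p : ℕ} {f g : (V → ℝ) → V → ℝ}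

/-- A continuous order-preserving map of the nonnegative cone that is homogeneous of degree `p`, the
setting of nonlinear Perron–Frobenius theory. Values outside the cone are unconstrained. -/
structure IsMonotoneHomogeneous (p : ℕ) (f : (V → ℝ) → V → ℝ) : Prop where
  continuousOn : ContinuousOn f (Set.Ici 0)
  monotoneOn : MonotoneOn f (Set.Ici 0)
  map_smul : ∀ ⦃c : ℝ⦄, 0 ≤ c → ∀ ⦃x : V → ℝ⦄, 0 ≤ x → f (c • x) = c ^ p • f x

/-- The numbers `μ` with `μ x^[p] ≤ f x` for some nonzero nonnegative `x`. Their supremum is the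
Collatz–Wielandt number of `f`. -/
def subeigenvalues (p : ℕ) (f : (V → ℝ) → V → ℝ) : Set ℝ :=
  {μ | ∃ x, 0 < x ∧ μ • x ^ p ≤ f x}

theorem subeigenvalues_mono (hfg : ∀ x, 0 ≤ x → f x ≤ g x) :
    subeigenvalues p f ⊆ subeigenvalues p g :=
  fun _ ⟨x, hx, hμ⟩ => ⟨x, hx, hμ.trans (hfg x hx.le)⟩

theorem pos_of_mem_stdSimplex [Fintype V] {x : V → ℝ} (hx : x ∈ stdSimplex ℝ V) : 0 < x := by
  refine lt_of_le_of_ne hx.1 ?_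
  rintro rfl
  simpa using hx.2

theorem exists_gt_smul_le_of_strongLT [Finite V] {r : ℝ} {a b : V → ℝ} (h : StrongLT (r • a) b) :
    ∃ μ > r, μ • a ≤ b := by
  have hev : ∀ᶠ μ in 𝓝[>] r, ∀ i, μ * a i ≤ b i := by
    refine eventually_all.2 fun i => ?_
    have hlim : Tendsto (fun μ : ℝ => μ * a i) (𝓝[>] r) (𝓝 (r * a i)) :=
      (Continuous.tendsto (by fun_prop) r).mono_left nhdsWithin_le_nhds
    exact (hlim.eventually (gt_mem_nhds (h i))).mono fun _ => le_of_lt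
  obtain ⟨μ, hμ, hrμ⟩ := (hev.and self_mem_nhdsWithin).exists
  exact ⟨μ, hrμ, hμ⟩

namespace IsMonotoneHomogeneous

theorem map_nonneg (hf : IsMonotoneHomogeneous p f) (hp : p ≠ 0) {x : V → ℝ} (hx : 0 ≤ x) :
    0 ≤ f x := by
  have map_zero : f 0 = 0 := by simpa [hp] using hf.map_smul le_rfl (le_refl (0 : V → ℝ))
  exact map_zero ▸ hf.monotoneOn Set.self_mem_Ici hx hx

theorem zero_mem_subeigenvalues [Nonempty V] (hf : IsMonotoneHomogeneous p f) (hp : p ≠ 0) :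
    0 ∈ subeigenvalues p f :=
  ⟨1, one_pos, by simpa using hf.map_nonneg hp zero_le_one⟩

-- The largest ratio `x i / w i` gives the smallest multiple of `w` that dominates `x`.
theorem le_of_mem_subeigenvalues [Finite V] (hf : IsMonotoneHomogeneous p f) {μ ν : ℝ}
    (hμ : μ ∈ subeigenvalues p f) {w : V → ℝ} (hw : ∀ i, 0 < w i) (hν : f w ≤ ν • w ^ p) :
    μ ≤ ν := by
  obtain ⟨x, hx, hμx⟩ := hμ
  obtain ⟨hx0, j, hj⟩ := Pi.lt_def.1 hx
  have : Nonempty V := ⟨j⟩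
  obtain ⟨i, hi⟩ := Finite.exists_max fun i => x i / w i
  set s : ℝ := x i / w i
  have hs : 0 < s := (div_pos hj (hw j)).trans_le (hi j)
  have hxi : x i = s * w i := (div_mul_cancel₀ _ (hw i).ne').symm
  have hxs : x ≤ s • w := fun k => (div_le_iff₀ (hw k)).1 (hi k)
  have hpos : 0 < x i ^ p := pow_pos (hxi ▸ mul_pos hs (hw i)) p
  refine le_of_mul_le_mul_right ?_ hpos
  calc μ * x i ^ p ≤ f x i := hμx i
    _ ≤ f (s • w) i := hf.monotoneOn hx0 (hx0.trans hxs) hxs i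
    _ = s ^ p * f w i := by rw [hf.map_smul hs.le fun k => (hw k).le, Pi.smul_apply, smul_eq_mul]
    _ ≤ s ^ p * (ν * w i ^ p) := by gcongr; exact hν i
    _ = ν * x i ^ p := by rw [hxi]; ring

theorem exists_mem_stdSimplex_smul_pow_le [Fintype V] (hf : IsMonotoneHomogeneous p f)
    {μ : ℝ} (hμ : μ ∈ subeigenvalues p f) : ∃ x ∈ stdSimplex ℝ V, μ • x ^ p ≤ f x := by
  obtain ⟨x, hx, hμx⟩ := hμ
  have hsum : 0 < ∑ i, x i := Fintype.sum_pos hx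
  have hc : 0 ≤ (∑ i, x i)⁻¹ := (inv_pos.2 hsum).le
  refine ⟨(∑ i, x i)⁻¹ • x, ⟨smul_nonneg hc hx.le, ?_⟩, ?_⟩
  · simp only [Pi.smul_apply, smul_eq_mul, ← Finset.mul_sum, inv_mul_cancel₀ hsum.ne']
  · rw [hf.map_smul hc hx.le, smul_pow, smul_comm]
    exact smul_le_smul_of_nonneg_left hμx (pow_nonneg hc p)

theorem exists_isGreatest_subeigenvalues [Finite V] [Nonempty V] (hf : IsMonotoneHomogeneous p f)
    (hp : p ≠ 0) : ∃ r, IsGreatest (subeigenvalues p f) r := by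
  have := Fintype.ofFinite V
  have hbound : ∀ μ ∈ subeigenvalues p f, μ ≤ ∑ i, f 1 i := fun μ hμ => by
    refine hf.le_of_mem_subeigenvalues hμ (w := 1) (fun _ => one_pos) fun i => ?_
    simpa using Finset.single_le_sum (fun j _ => hf.map_nonneg hp zero_le_one j)
      (Finset.mem_univ i)
  let K : Set (ℝ × (V → ℝ)) := Set.Icc 0 (∑ i, f 1 i) ×ˢ stdSimplex ℝ V
  have hK : IsCompact K := isCompact_Icc.prod (isCompact_stdSimplex ℝ V)
  let S : Set (ℝ × (V → ℝ)) := {q ∈ K | q.1 • q.2 ^ p ≤ f q.2}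
  have hS : IsCompact S := by
    refine hK.of_isClosed_subset (hK.isClosed.isClosed_le (by fun_prop) ?_) (Set.sep_subset _ _)
    exact hf.continuousOn.comp continuousOn_snd fun q hq => hq.2.1
  have mem_fst_image : ∀ μ ∈ subeigenvalues p f, 0 ≤ μ → μ ∈ Prod.fst '' S := fun μ hμ hμ0 => by
    obtain ⟨x, hx, hμx⟩ := hf.exists_mem_stdSimplex_smul_pow_le hμ
    exact ⟨(μ, x), ⟨⟨⟨hμ0, hbound μ hμ⟩, hx⟩, hμx⟩, rfl⟩
  have hne := mem_fst_image 0 (hf.zero_mem_subeigenvalues hp) le_rfl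
  obtain ⟨r, ⟨q, hq, rfl⟩, hmax⟩ := (hS.image continuous_fst).exists_isGreatest ⟨0, hne⟩
  refine ⟨q.1, ⟨q.2, pos_of_mem_stdSimplex hq.1.2, hq.2⟩, fun μ hμ => ?_⟩
  rcases le_total 0 μ with hμ0 | hμ0
  · exact hmax (mem_fst_image μ hμ hμ0)
  · exact hμ0.trans hq.1.1.1

-- Otherwise `z = (f x)^[1/p]` lies above `r^(1/p) x` and differs from it, so `f z` exceeds
-- `r z^[p]` strictly in every coordinate, and `r` could be increased.
theorem eq_smul_pow_of_isGreatest [Finite V] [Nonempty V] (hf : IsMonotoneHomogeneous p f)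
    (hp : p ≠ 0) (hstrict : ∀ x y, 0 ≤ x → x < y → StrongLT (f x) (f y)) {r : ℝ}
    (hr : IsGreatest (subeigenvalues p f) r) {x : V → ℝ} (hx : 0 ≤ x) (hrx : r • x ^ p ≤ f x) :
    f x = r • x ^ p := by
  have hr0 : 0 ≤ r := hr.2 (hf.zero_mem_subeigenvalues hp)
  obtain ⟨c, hc, rfl⟩ : ∃ c : ℝ, 0 ≤ c ∧ c ^ p = r :=
    ⟨r ^ (p : ℝ)⁻¹, Real.rpow_nonneg hr0 _, Real.rpow_inv_natCast_pow hr0 hp⟩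
  obtain ⟨z, hz, hzp⟩ : ∃ z : V → ℝ, 0 ≤ z ∧ z ^ p = f x :=
    ⟨fun i => f x i ^ (p : ℝ)⁻¹, fun i => Real.rpow_nonneg (hf.map_nonneg hp hx i) _,
      funext fun i => Real.rpow_inv_natCast_pow (hf.map_nonneg hp hx i) hp⟩
  rw [← smul_pow] at hrx ⊢
  have hle : c • x ≤ z := fun i => le_of_pow_le_pow_left₀ hp (hz i) ((hrx.trans hzp.ge) i)
  by_contra hne
  have hlt : c • x < z := lt_of_le_of_ne hle fun h => hne (by rw [h, hzp])
  have hcx : 0 ≤ c • x := smul_nonneg hc hx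
  have hgap : StrongLT (c ^ p • z ^ p) (f z) := by
    rw [hzp, ← hf.map_smul hc hx]
    exact hstrict _ _ hcx hlt
  obtain ⟨μ, hμ, hμz⟩ := exists_gt_smul_le_of_strongLT hgap
  exact hμ.not_ge (hr.2 ⟨z, hcx.trans_lt hlt, hμz⟩)

variable [Fintype V]

theorem add_mul_sum_pow (hf : IsMonotoneHomogeneous p f) {ε : ℝ} (hε : 0 ≤ ε) :
    IsMonotoneHomogeneous p fun x i => f x i + ε * (∑ j, x j) ^ p where
  continuousOn := continuousOn_pi.2 fun i =>
    (continuousOn_pi.1 hf.continuousOn i).add (by fun_prop)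
  monotoneOn x hx y hy hxy i := by
    have := hf.monotoneOn hx hy hxy i
    have : 0 ≤ ∑ j, x j := Finset.sum_nonneg fun j _ => hx j
    dsimp only
    gcongr
    exact hxy _
  map_smul c hc x hx := by
    ext i
    simp only [hf.map_smul hc hx, Pi.smul_apply, smul_eq_mul, ← Finset.mul_sum]
    ring

theorem strongLT_add_mul_sum_pow (hf : IsMonotoneHomogeneous p f) (hp : p ≠ 0) {ε : ℝ} (hε : 0 < ε)
    {x y : V → ℝ} (hx : 0 ≤ x) (hxy : x < y) :
    StrongLT (fun i => f x i + ε * (∑ j, x j) ^ p) (fun i => f y i + ε * (∑ j, y j) ^ p) := by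
  intro i
  have hsum : ∑ j, x j < ∑ j, y j := Fintype.sum_strictMono hxy
  have hsum0 : 0 ≤ ∑ j, x j := Finset.sum_nonneg fun j _ => hx j
  have hmono : f x i ≤ f y i := hf.monotoneOn hx (hx.trans hxy.le) hxy.le i
  exact add_lt_add_of_le_of_lt hmono (by gcongr)

theorem exists_eigenvector_add_mul_sum_pow [Nonempty V] (hf : IsMonotoneHomogeneous p f)
    (hp : p ≠ 0) {ε : ℝ} (hε : 0 < ε) :
    ∃ r, IsGreatest (subeigenvalues p fun x i => f x i + ε * (∑ j, x j) ^ p) r ∧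
      ∃ x ∈ stdSimplex ℝ V, ∀ i, f x i + ε = r * x i ^ p := by
  have hfε := hf.add_mul_sum_pow hε.le
  obtain ⟨r, hr⟩ := hfε.exists_isGreatest_subeigenvalues hp
  obtain ⟨x, hx, hrx⟩ := hfε.exists_mem_stdSimplex_smul_pow_le hr.1
  have heq := hfε.eq_smul_pow_of_isGreatest hp
    (fun _ _ => hf.strongLT_add_mul_sum_pow hp hε) hr hx.1 hrx
  exact ⟨r, hr, x, hx, fun i => by simpa [hx.2] using congrFun heq i⟩

-- Perturb `f` to a strictly monotone map, then let the perturbation tend to `0`.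
theorem exists_eigenvector [Nonempty V] (hf : IsMonotoneHomogeneous p f) (hp : p ≠ 0) :
    ∃ r, IsGreatest (subeigenvalues p f) r ∧ ∃ x ∈ stdSimplex ℝ V, f x = r • x ^ p := by
  let ε : ℕ → ℝ := fun k => 1 / (k + 1)
  have hε : ∀ k, 0 < ε k := fun k => Nat.one_div_pos_of_nat
  choose r hr x hx hrx using fun k => hf.exists_eigenvector_add_mul_sum_pow hp (hε k)
  have sum_pow_nonneg : ∀ y : V → ℝ, 0 ≤ y → 0 ≤ (∑ j, y j) ^ p := fun y hy =>
    pow_nonneg (Finset.sum_nonneg fun j _ => hy j) p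
  have le_r : ∀ k, ∀ μ ∈ subeigenvalues p f, μ ≤ r k := fun k μ hμ =>
    (hr k).2 <| subeigenvalues_mono
      (fun y hy i => le_add_of_nonneg_right (mul_nonneg (hε k).le (sum_pow_nonneg y hy))) hμ
  have r_le : ∀ k, r k ≤ r 0 := fun k => by
    refine (hr 0).2 (subeigenvalues_mono (fun y hy i => ?_) (hr k).1)
    have hεk : ε k ≤ ε 0 := Nat.one_div_le_one_div k.zero_le
    have := sum_pow_nonneg y hy
    dsimp only
    gcongr
  have hmem : ∀ k, (r k, x k) ∈ Set.Icc 0 (r 0) ×ˢ stdSimplex ℝ V := fun k =>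
    ⟨⟨le_r k 0 (hf.zero_mem_subeigenvalues hp), r_le k⟩, hx k⟩
  obtain ⟨⟨r', x'⟩, ⟨-, hx'⟩, φ, hφ, hlim⟩ :=
    (isCompact_Icc.prod (isCompact_stdSimplex ℝ V)).tendsto_subseq hmem
  obtain ⟨hlr, hlx⟩ := Prod.tendsto_iff _ _ |>.1 hlim
  have heig : f x' = r' • x' ^ p := by
    have hlf : Tendsto (fun k => f (x (φ k))) atTop (𝓝 (f x')) :=
      (hf.continuousOn x' hx'.1).tendsto.comp <|
        tendsto_nhdsWithin_iff.2 ⟨hlx, .of_forall fun k => (hx _).1⟩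
    have hlε : Tendsto (fun k => ε (φ k)) atTop (𝓝 0) :=
      tendsto_one_div_add_atTop_nhds_zero_nat.comp hφ.tendsto_atTop
    ext i
    have hleft := (tendsto_pi_nhds.1 hlf i).add hlε
    rw [add_zero] at hleft
    exact tendsto_nhds_unique (hleft.congr fun k => hrx (φ k) i)
      (hlr.mul ((tendsto_pi_nhds.1 hlx i).pow p))
  exact ⟨r', ⟨⟨x', pos_of_mem_stdSimplex hx', heig.ge⟩,
    fun μ hμ => ge_of_tendsto' hlr fun k => le_r _ μ hμ⟩, x', hx', heig⟩

end IsMonotoneHomogeneous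

end PerronFrobenius

namespace Hypermatrix

variable {m : ℕ} [NeZero m] {V : Type*} [Fintype V] [DecidableEq V] {A : Hypermatrix m V}

/-- `A x^{m-1}` for a real vector `x`, the counterpart of `Hypermatrix.apply` for which the order
structure of `V → ℝ` is available. -/
noncomputable def realApply (A : Hypermatrix m V) (x : V → ℝ) (i : V) : ℝ :=
  ∑ I : Fin m → V with I 0 = i, A I * ∏ j ∈ Finset.univ.erase (0 : Fin m), x (I j)

theorem apply_ofReal (A : Hypermatrix m V) (x : V → ℝ) (i : V) :
    A.apply (fun v => (x v : ℂ)) i = (A.realApply x i : ℂ) := by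
  simp [apply, realApply]

theorem norm_apply_le_realApply_norm (hA : 0 ≤ A) (x : V → ℂ) (i : V) :
    ‖A.apply x i‖ ≤ A.realApply (fun v => ‖x v‖) i := by
  refine (norm_sum_le _ _).trans (Finset.sum_le_sum fun I _ => ?_)
  rw [norm_mul, norm_prod, Complex.norm_real, Real.norm_of_nonneg (hA I)]

theorem realApply_smul (A : Hypermatrix m V) (c : ℝ) (x : V → ℝ) :
    A.realApply (c • x) = c ^ (m - 1) • A.realApply x := by
  ext i
  simp only [realApply, Pi.smul_apply, smul_eq_mul, Finset.mul_sum, Finset.prod_mul_distrib,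
    Finset.prod_const, Finset.card_erase_of_mem (Finset.mem_univ _), Finset.card_univ,
    Fintype.card_fin]
  exact Finset.sum_congr rfl fun I _ => mul_left_comm _ _ _

theorem isMonotoneHomogeneous_realApply (hA : 0 ≤ A) :
    IsMonotoneHomogeneous (m - 1) A.realApply where
  continuousOn := Continuous.continuousOn <| by unfold realApply; fun_prop
  monotoneOn x hx y _ hxy i := by
    refine Finset.sum_le_sum fun I _ => mul_le_mul_of_nonneg_left ?_ (hA I)
    exact Finset.prod_le_prod (fun j _ => hx (I j)) fun j _ => hxy (I j)
  map_smul c _ x _ := A.realApply_smul c x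

theorem isEigenvalue_ofReal {r : ℝ} {x : V → ℝ} (hx : x ≠ 0)
    (hrx : A.realApply x = r • x ^ (m - 1)) : A.IsEigenvalue r := by
  refine ⟨fun v => x v, fun h => hx ?_, fun i => ?_⟩
  · ext i
    simpa using congrFun h i
  · rw [apply_ofReal, hrx]
    simp

theorem norm_mem_subeigenvalues (hA : 0 ≤ A) {l : ℂ} (hl : A.IsEigenvalue l) :
    ‖l‖ ∈ subeigenvalues (m - 1) A.realApply := by
  obtain ⟨x, hx, hlx⟩ := hl
  refine ⟨fun v => ‖x v‖, lt_of_le_of_ne (fun v => norm_nonneg _) fun h => hx ?_, fun i => ?_⟩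
  · ext i
    exact norm_eq_zero.1 (congrFun h i).symm
  · calc ‖l‖ * ‖x i‖ ^ (m - 1) = ‖A.apply x i‖ := by rw [hlx, norm_mul, norm_pow]
      _ ≤ A.realApply (fun v => ‖x v‖) i := norm_apply_le_realApply_norm hA x i

theorem spectralRadius_nonneg : 0 ≤ A.spectralRadius :=
  Real.sSup_nonneg fun _ ⟨l, _, hr⟩ => hr ▸ norm_nonneg l

variable [Nonempty V]

theorem exists_isGreatest_subeigenvalues_and_eigenvalueModuli (hm : 2 ≤ m) (hA : 0 ≤ A) :
    ∃ r, IsGreatest (subeigenvalues (m - 1) A.realApply) r ∧ IsGreatest A.eigenvalueModuli r := by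
  have hp : m - 1 ≠ 0 := by omega
  have hf := isMonotoneHomogeneous_realApply hA
  obtain ⟨r, hr, x, hx, hrx⟩ := hf.exists_eigenvector hp
  have hr0 : 0 ≤ r := hr.2 (hf.zero_mem_subeigenvalues hp)
  refine ⟨r, hr, ⟨r, isEigenvalue_ofReal (pos_of_mem_stdSimplex hx).ne' hrx, ?_⟩, ?_⟩
  · rw [Complex.norm_real, Real.norm_of_nonneg hr0]
  · rintro _ ⟨l, hl, rfl⟩
    exact hr.2 (norm_mem_subeigenvalues hA hl)

theorem isGreatest_subeigenvalues_zero :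
    IsGreatest (subeigenvalues (m - 1) (0 : Hypermatrix m V).realApply) 0 := by
  have hzero : ∀ x, (0 : Hypermatrix m V).realApply x = 0 := fun x => by
    ext i
    simp [realApply]
  refine ⟨⟨1, one_pos, by simp [hzero]⟩, fun μ ⟨x, hx, hμx⟩ => ?_⟩
  obtain ⟨-, i, hi⟩ := Pi.lt_def.1 hx
  rw [hzero] at hμx
  exact nonpos_of_mul_nonpos_left (hμx i) (pow_pos hi _)

theorem isGreatest_eigenvalueModuli_zero : IsGreatest (0 : Hypermatrix m V).eigenvalueModuli 0 := by
  have happly : ∀ x i, (0 : Hypermatrix m V).apply x i = 0 := fun x i => by simp [apply]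
  refine ⟨⟨0, ⟨1, one_ne_zero, fun i => by simp [happly]⟩, norm_zero.symm⟩, ?_⟩
  rintro _ ⟨l, ⟨x, hx, hlx⟩, rfl⟩
  obtain ⟨i, hi⟩ := Function.ne_iff.1 hx
  have hl : l * x i ^ (m - 1) = 0 := by rw [← hlx, happly]
  exact norm_le_zero_iff.2 ((mul_eq_zero_iff_right (pow_ne_zero _ hi)).1 hl)

end Hypermatrix

section Listings

open Finset

/-- Injective maps that respect a colouring are families of embeddings between colour classes. -/
def injectiveMemEquivPiEmbedding {α ι β : Type*} (c : α → ι) (B : ι → Finset β)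
    (hB : Pairwise (Function.onFun Disjoint B)) :
    {I : α → β // Function.Injective I ∧ ∀ a, I a ∈ B (c a)} ≃
      ∀ d, {a // c a = d} ↪ B d where
  toFun I d := ⟨fun a => ⟨I.1 a, by simpa only [a.2] using I.2.2 a⟩, fun _ _ h =>
    Subtype.ext (I.2.1 (Subtype.ext_iff.1 h))⟩
  invFun g := by
    refine ⟨fun a => g (c a) ⟨a, rfl⟩, fun a b hab => ?_, fun a => (g (c a) ⟨a, rfl⟩).2⟩
    dsimp only at hab
    have hc : c a = c b := by
      by_contra hne
      exact disjoint_left.1 (hB hne) (g (c a) ⟨a, rfl⟩).2 (hab ▸ (g (c b) ⟨b, rfl⟩).2)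
    have g_apply : ∀ d (h : c a = d), (g (c a) ⟨a, rfl⟩ : β) = g d ⟨a, h⟩ := by rintro _ rfl; rfl
    rw [g_apply _ hc] at hab
    exact Subtype.ext_iff.1 ((g (c b)).injective (Subtype.ext hab))
  left_inv I := rfl
  right_inv g := by
    ext d ⟨a, rfl⟩
    rfl

theorem card_injective_mem {α ι β : Type*} [Fintype α] [Fintype ι] [DecidableEq ι] (c : α → ι)
    {B : ι → Finset β} (hB : Pairwise (Function.onFun Disjoint B)) :
    Nat.card {I : α → β // Function.Injective I ∧ ∀ a, I a ∈ B (c a)} =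
      ∏ d, (#(B d)).descFactorial #{a | c a = d} := by
  rw [Nat.card_congr (injectiveMemEquivPiEmbedding c B hB), Nat.card_pi]
  refine Finset.prod_congr rfl fun d _ => ?_
  classical
  rw [Nat.card_eq_fintype_card, Fintype.card_embedding_eq, Fintype.card_coe, Fintype.card_subtype]

theorem card_filter_le_val (m k : ℕ) : #{j : Fin m | k ≤ (j : ℕ)} = m - k := by
  simp only [← not_lt, ← compl_filter, card_compl, Fintype.card_fin, Fin.card_filter_val_lt]
  omega

namespace DirectedHypergraph

variable {V : Type*} [DecidableEq V] {m : ℕ} {I : Fin m → V} {e : Finset V × Finset V} {i : V}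

theorem ListsEdge.image_univ (hI : ListsEdge I e) : univ.image I = e.1 ∪ e.2 := by
  obtain ⟨-, htail, hhead⟩ := hI
  rw [← htail, ← hhead, ← image_union]
  simp only [← not_lt, filter_union_filter_not_eq]

theorem listsEdge_iff (hdisj : Disjoint e.1 e.2) (hcard : #(e.1 ∪ e.2) = m) :
    ListsEdge I e ↔ Function.Injective I ∧
      ∀ j : Fin m, ((j : ℕ) < #e.1 → I j ∈ e.1) ∧ (#e.1 ≤ (j : ℕ) → I j ∈ e.2) := by
  rw [card_union_of_disjoint hdisj] at hcard
  have htail : #{j : Fin m | (j : ℕ) < #e.1} = #e.1 := by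
    rw [Fin.card_filter_val_lt]; omega
  have hhead : #{j : Fin m | #e.1 ≤ (j : ℕ)} = #e.2 := by
    rw [card_filter_le_val]; omega
  refine and_congr_right fun hinj => ⟨fun ⟨h1, h2⟩ j => ⟨fun hj => ?_, fun hj => ?_⟩,
    fun h => ⟨eq_of_subset_of_card_le ?_ ?_, eq_of_subset_of_card_le ?_ ?_⟩⟩
  · exact h1.subset (mem_image_of_mem _ (by simpa using hj))
  · exact h2.subset (mem_image_of_mem _ (by simpa using hj))
  · exact image_subset_iff.2 fun j hj => (h j).1 (mem_filter.1 hj).2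
  · rw [card_image_of_injective _ hinj, htail]
  · exact image_subset_iff.2 fun j hj => (h j).2 (mem_filter.1 hj).2
  · rw [card_image_of_injective _ hinj, hhead]

variable [NeZero m]

theorem ListsEdge.apply_zero_mem_tail (hI : ListsEdge I e) (hne : e.1.Nonempty) : I 0 ∈ e.1 :=
  hI.2.1.subset (mem_image_of_mem _ (by simpa using hne))

theorem ListsEdge.prod_erase_zero {M : Type*} [CommMonoid M] (hI : ListsEdge I e) (w : V → M) :
    ∏ j ∈ univ.erase (0 : Fin m), w (I j) = ∏ v ∈ (e.1 ∪ e.2).erase (I 0), w v := by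
  rw [← hI.image_univ, ← image_erase hI.1, prod_image fun a _ b _ h => hI.1 h]

/-- Splits the positions of a multi-index into the first one, the others below `k`, and the rest. -/
def positionBlock (k : ℕ) (j : Fin m) : Fin 3 :=
  if j = 0 then 0 else if (j : ℕ) < k then 1 else 2

/-- The vertices of `e` that a listing of `e` starting at `i` has in each `positionBlock`. -/
def vertexBlock (i : V) (e : Finset V × Finset V) : Fin 3 → Finset V :=
  ![{i}, e.1.erase i, e.2]

theorem pairwise_disjoint_vertexBlock (hdisj : Disjoint e.1 e.2) (hi : i ∈ e.1) :
    Pairwise (Function.onFun Disjoint (vertexBlock i e)) := by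
  have hhead : Disjoint (e.1.erase i) e.2 := hdisj.mono_left (erase_subset _ _)
  have hi2 : i ∉ e.2 := disjoint_left.1 hdisj hi
  intro a b hab
  fin_cases a <;> fin_cases b <;>
    simp_all [Function.onFun, vertexBlock, disjoint_comm]

theorem card_filter_positionBlock {k : ℕ} (hk : 0 < k) (hkm : k ≤ m) (d : Fin 3) :
    #{j : Fin m | positionBlock k j = d} = ![1, k - 1, m - k] d := by
  have heq_zero : (univ.filter fun j : Fin m => positionBlock k j = 0) = {0} := by
    ext j; rw [mem_filter_univ, positionBlock]; split_ifs <;> simp_all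
  have heq_one : (univ.filter fun j : Fin m => positionBlock k j = 1) =
      (univ.filter fun j : Fin m => (j : ℕ) < k).erase 0 := by
    ext j; rw [mem_filter_univ, positionBlock]; split_ifs <;> simp_all
  have heq_two : (univ.filter fun j : Fin m => positionBlock k j = 2) =
      univ.filter fun j : Fin m => k ≤ (j : ℕ) := by
    ext j; rw [mem_filter_univ, positionBlock]; split_ifs <;> simp_all [hk.ne']
  fin_cases d
  · exact heq_zero ▸ card_singleton _
  · refine (congrArg card heq_one).trans ?_
    rw [card_erase_of_mem (by simpa using hk), Fin.card_filter_val_lt, min_eq_right hkm]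
    rfl
  · exact (congrArg card heq_two).trans (card_filter_le_val m k)

theorem listsEdge_and_apply_zero_eq_iff (hdisj : Disjoint e.1 e.2) (hcard : #(e.1 ∪ e.2) = m)
    (hi : i ∈ e.1) : ListsEdge I e ∧ I 0 = i ↔
      Function.Injective I ∧ ∀ j, I j ∈ vertexBlock i e (positionBlock #e.1 j) := by
  have hk : 0 < #e.1 := card_pos.2 ⟨i, hi⟩
  rw [listsEdge_iff hdisj hcard, and_assoc]
  refine and_congr_right fun hinj => ⟨fun ⟨h, h0⟩ j => ?_, fun h => ?_⟩
  · have hj : I j = i ↔ j = 0 := h0 ▸ hinj.eq_iff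
    unfold positionBlock
    split_ifs with hj0 hjk
    · simp [vertexBlock, hj0, h0]
    · simp [vertexBlock, hj, hj0, (h j).1 hjk]
    · simp [vertexBlock, (h j).2 (not_lt.1 hjk)]
  · have h0 : I 0 = i := by simpa [positionBlock, vertexBlock] using h 0
    refine ⟨fun j => ?_, h0⟩
    rcases eq_or_ne j 0 with rfl | hj0
    · simp [h0, hi, hk.ne']
    · refine ⟨fun hjk => ?_, fun hjk => ?_⟩
      · exact mem_of_mem_erase (by simpa [positionBlock, vertexBlock, hj0, hjk] using h j)
      · simpa [positionBlock, vertexBlock, hj0, not_lt.2 hjk] using h j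

theorem card_listsEdge (hdisj : Disjoint e.1 e.2) (hcard : #(e.1 ∪ e.2) = m) (hi : i ∈ e.1) :
    Nat.card {I : Fin m → V // ListsEdge I e ∧ I 0 = i} =
      (m - #e.1).factorial * (#e.1 - 1).factorial := by
  have hk : 0 < #e.1 := card_pos.2 ⟨i, hi⟩
  have hsum : #e.1 + #e.2 = m := by rw [← card_union_of_disjoint hdisj, hcard]
  simp_rw [listsEdge_and_apply_zero_eq_iff hdisj hcard hi]
  rw [card_injective_mem _ (pairwise_disjoint_vertexBlock hdisj hi), Fin.prod_univ_three]
  simp only [card_filter_positionBlock hk (Nat.le.intro hsum)]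
  have hhead : #e.2 = m - #e.1 := by omega
  simp [vertexBlock, hi, hhead, Nat.descFactorial_self, mul_comm]

end DirectedHypergraph

end Listings

section OutAdjacency

open Finset

namespace DirectedHypergraph

variable {V : Type*} [DecidableEq V] {H : DirectedHypergraph V} {m : ℕ}

theorem outAdjacency_nonneg : 0 ≤ H.outAdjacency m := fun I =>
  sum_nonneg fun e _ => by split_ifs <;> positivity

theorem outAdjacency_eq_zero (h : H.edges = ∅) : H.outAdjacency m = 0 := by
  ext I
  simp [outAdjacency, h]

theorem IsUniform.two_le (hH : H.IsUniform m) (hne : H.edges.Nonempty) : 2 ≤ m := by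
  obtain ⟨e, he⟩ := hne
  rw [← hH e he, card_union_of_disjoint (H.disjoint e he)]
  exact Nat.add_le_add (card_pos.2 (H.tail_nonempty e he)) (card_pos.2 (H.head_nonempty e he))

variable [Fintype V] [NeZero m]

theorem IsUniform.exists_isGreatest_subeigenvalues_and_eigenvalueModuli [Nonempty V]
    (hH : H.IsUniform m) :
    ∃ r, IsGreatest (subeigenvalues (m - 1) (H.outAdjacency m).realApply) r ∧
      IsGreatest (H.outAdjacency m).eigenvalueModuli r := by
  rcases H.edges.eq_empty_or_nonempty with hempty | hne
  · rw [outAdjacency_eq_zero hempty]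
    exact ⟨0, Hypermatrix.isGreatest_subeigenvalues_zero,
      Hypermatrix.isGreatest_eigenvalueModuli_zero⟩
  · exact Hypermatrix.exists_isGreatest_subeigenvalues_and_eigenvalueModuli (hH.two_le hne)
      outAdjacency_nonneg

theorem IsUniform.isGreatest_eigenvalueModuli_outAdjacency [Nonempty V] (hH : H.IsUniform m) :
    IsGreatest (H.outAdjacency m).eigenvalueModuli (H.outAdjacency m).spectralRadius := by
  obtain ⟨r, -, hr⟩ := hH.exists_isGreatest_subeigenvalues_and_eigenvalueModuli
  rwa [Hypermatrix.spectralRadius, hr.csSup_eq]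

theorem IsUniform.isGreatest_subeigenvalues_outAdjacency [Nonempty V] (hH : H.IsUniform m) :
    IsGreatest (subeigenvalues (m - 1) (H.outAdjacency m).realApply)
      (H.outAdjacency m).spectralRadius := by
  obtain ⟨r, hr, hr'⟩ := hH.exists_isGreatest_subeigenvalues_and_eigenvalueModuli
  rwa [Hypermatrix.spectralRadius, hr'.csSup_eq]

open Classical in
theorem sum_ite_listsEdge_mul_prod {e : Finset V × Finset V} (hne : e.1.Nonempty)
    (hdisj : Disjoint e.1 e.2) (hcard : #(e.1 ∪ e.2) = m) (w : V → ℝ) (i : V) :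
    ∑ I : Fin m → V with I 0 = i, (if ListsEdge I e then
        1 / (((m - #e.1).factorial : ℝ) * ((#e.1 - 1).factorial : ℝ)) else 0) *
          ∏ j ∈ univ.erase (0 : Fin m), w (I j) =
      if i ∈ e.1 then ∏ v ∈ (e.1 ∪ e.2).erase i, w v else 0 := by
  simp only [ite_mul, zero_mul]
  rw [← sum_filter, filter_filter, sum_congr rfl fun I hI => by
    rw [(mem_filter.1 hI).2.2.prod_erase_zero, (mem_filter.1 hI).2.1], sum_const, nsmul_eq_mul]
  split_ifs with hi
  · have hcount : #{I : Fin m → V | I 0 = i ∧ ListsEdge I e} =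
        (m - #e.1).factorial * (#e.1 - 1).factorial := by
      rw [← card_listsEdge hdisj hcard hi]
      exact (Nat.subtype_card _ fun I => by simp [and_comm]).symm
    rw [hcount]
    push_cast
    field_simp
  · rw [filter_false_of_mem, card_empty, Nat.cast_zero, zero_mul]
    rintro I - ⟨rfl, hI⟩
    exact hi (hI.apply_zero_mem_tail hne)

theorem IsUniform.realApply_outAdjacency (hH : H.IsUniform m) (w : V → ℝ) (i : V) :
    (H.outAdjacency m).realApply w i =
      ∑ e ∈ H.edges with i ∈ e.1, ∏ v ∈ (e.1 ∪ e.2).erase i, w v := by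
  simp only [Hypermatrix.realApply, outAdjacency, sum_mul]
  rw [sum_comm, sum_filter]
  exact sum_congr rfl fun e he => sum_ite_listsEdge_mul_prod (H.tail_nonempty e he)
    (H.disjoint e he) (hH e he) w i

theorem IsUniform.realApply_outAdjacency_mulSingle (hH : H.IsUniform m) (a : V) (t : ℝ) (i : V) :
    (H.outAdjacency m).realApply (Pi.mulSingle a t) i =
      ∑ e ∈ H.edges with i ∈ e.1, if a ∈ (e.1 ∪ e.2).erase i then t else 1 := by
  simp only [hH.realApply_outAdjacency, prod_pi_mulSingle']

theorem IsUniform.realApply_outAdjacency_mulSingle_self (hH : H.IsUniform m) (a : V) (t : ℝ) :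
    (H.outAdjacency m).realApply (Pi.mulSingle a t) a = H.outDegree a := by
  simp [hH.realApply_outAdjacency_mulSingle, outDegree]

theorem IsUniform.outDegree_mul_le_realApply_outAdjacency_mulSingle (hH : H.IsUniform m) (a : V)
    {t : ℝ} (ht : t ≤ 1) (i : V) :
    H.outDegree i * t ≤ (H.outAdjacency m).realApply (Pi.mulSingle a t) i := by
  rw [hH.realApply_outAdjacency_mulSingle, outDegree, ← nsmul_eq_mul]
  exact card_nsmul_le_sum _ _ _ fun e _ => by split_ifs <;> simp [ht]

theorem IsUniform.realApply_outAdjacency_mulSingle_le_outDegree_mul (hH : H.IsUniform m) (a : V)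
    {t : ℝ} (ht : 1 ≤ t) (i : V) :
    (H.outAdjacency m).realApply (Pi.mulSingle a t) i ≤ H.outDegree i * t := by
  rw [hH.realApply_outAdjacency_mulSingle, outDegree, ← nsmul_eq_mul]
  exact sum_le_card_nsmul _ _ _ fun e _ => by split_ifs <;> simp [ht]

end DirectedHypergraph

end OutAdjacency

section Bounds

open Filter Topology

-- `t = (d / D) ^ (1 / m)` solves `d / t ^ (m - 1) = D * t`, so the vector equal to `t` at a vertex
-- of degree `d` and to `1` at vertices of degree `D` gives the same bound in all coordinates.
theorem exists_pos_mul_pow_eq_and_mul_eq_rpow {m : ℕ} (hm : m ≠ 0) {d D : ℝ} (hd : 0 < d)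
    (hD : 0 < D) :
    ∃ t > 0, D * t ^ m = d ∧ D * t = d ^ (1 / (m : ℝ)) * D ^ (1 - 1 / (m : ℝ)) := by
  have hquot : 0 < d / D := div_pos hd hD
  refine ⟨(d / D) ^ (1 / (m : ℝ)), Real.rpow_pos_of_pos hquot _, ?_, ?_⟩
  · rw [one_div, Real.rpow_inv_natCast_pow hquot.le hm, mul_div_cancel₀ _ hD.ne']
  · rw [Real.div_rpow hd.le hD.le, Real.rpow_sub hD, Real.rpow_one]
    ring

section MulSingle

variable {V R : Type*} [DecidableEq V]

theorem smul_mulSingle_pow_apply_self [Monoid R] {m : ℕ} (hm : m ≠ 0) (D t : R) (a : V) :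
    ((D * t) • (Pi.mulSingle a t : V → R) ^ (m - 1)) a = D * t ^ m := by
  rw [Pi.smul_apply, Pi.pow_apply, Pi.mulSingle_eq_same, smul_eq_mul, mul_assoc, mul_pow_sub_one hm]

theorem smul_mulSingle_pow_apply_of_ne [Monoid R] {a i : V} (hi : i ≠ a) (c t : R) (p : ℕ) :
    (c • (Pi.mulSingle a t : V → R) ^ p) i = c := by
  rw [Pi.smul_apply, Pi.pow_apply, Pi.mulSingle_eq_of_ne hi, one_pow, smul_eq_mul, mul_one]

theorem mulSingle_apply_pos [Zero R] [One R] [PartialOrder R] [ZeroLEOneClass R] [NeZero (1 : R)]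
    (a : V) {t : R} (ht : 0 < t) (i : V) : 0 < (Pi.mulSingle a t : V → R) i := by
  rcases eq_or_ne i a with rfl | hi
  · rwa [Pi.mulSingle_eq_same]
  · rw [Pi.mulSingle_eq_of_ne hi]
    exact zero_lt_one

end MulSingle

namespace DirectedHypergraph

variable {V : Type*} [Fintype V] [DecidableEq V] {H : DirectedHypergraph V} {m : ℕ} [NeZero m]
  {a : V} {d D : ℝ}

theorem IsUniform.le_spectralRadius_outAdjacency (hH : H.IsUniform m) (hd : 0 ≤ d)
    (hdD : d ≤ D) (ha : d ≤ H.outDegree a) (hne : ∀ v ≠ a, D ≤ H.outDegree v) :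
    d ^ (1 / (m : ℝ)) * D ^ (1 - 1 / (m : ℝ)) ≤ (H.outAdjacency m).spectralRadius := by
  have : Nonempty V := ⟨a⟩
  have hm0 : m ≠ 0 := NeZero.ne m
  rcases hd.eq_or_lt with rfl | hd
  · rw [Real.zero_rpow (one_div_ne_zero (Nat.cast_ne_zero.2 hm0)), zero_mul]
    exact Hypermatrix.spectralRadius_nonneg
  have hD : 0 < D := hd.trans_le hdD
  obtain ⟨t, ht, htm, htd⟩ := exists_pos_mul_pow_eq_and_mul_eq_rpow hm0 hd hD
  have ht1 : t ≤ 1 := by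
    refine (pow_le_one_iff_of_nonneg ht.le hm0).1 (le_of_mul_le_mul_left ?_ hD)
    rwa [htm, mul_one]
  rw [← htd]
  refine hH.isGreatest_subeigenvalues_outAdjacency.2 ?_
  have hpos : StrongLT 0 (Pi.mulSingle a t : V → ℝ) := mulSingle_apply_pos a ht
  refine ⟨Pi.mulSingle a t, hpos.lt, fun i => ?_⟩
  rcases eq_or_ne i a with rfl | hi
  · rw [smul_mulSingle_pow_apply_self hm0, hH.realApply_outAdjacency_mulSingle_self, htm]
    exact ha
  · rw [smul_mulSingle_pow_apply_of_ne hi]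
    refine le_trans ?_ (hH.outDegree_mul_le_realApply_outAdjacency_mulSingle a ht1 i)
    gcongr
    exact hne i hi

theorem IsUniform.spectralRadius_outAdjacency_le_of_pos (hH : H.IsUniform m)
    (hD : 0 < D) (hDd : D ≤ d) (ha : H.outDegree a ≤ d) (hne : ∀ v ≠ a, H.outDegree v ≤ D) :
    (H.outAdjacency m).spectralRadius ≤ d ^ (1 / (m : ℝ)) * D ^ (1 - 1 / (m : ℝ)) := by
  have : Nonempty V := ⟨a⟩
  have hm0 : m ≠ 0 := NeZero.ne m
  obtain ⟨t, ht, htm, htd⟩ := exists_pos_mul_pow_eq_and_mul_eq_rpow hm0 (hD.trans_le hDd) hD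
  have ht1 : 1 ≤ t := by
    refine (one_le_pow_iff_of_nonneg ht.le hm0).1 (le_of_mul_le_mul_left ?_ hD)
    rwa [htm, mul_one]
  rw [← htd]
  refine (Hypermatrix.isMonotoneHomogeneous_realApply outAdjacency_nonneg).le_of_mem_subeigenvalues
    hH.isGreatest_subeigenvalues_outAdjacency.1 (w := Pi.mulSingle a t)
    (mulSingle_apply_pos a ht) fun i => ?_
  rcases eq_or_ne i a with rfl | hi
  · rw [smul_mulSingle_pow_apply_self hm0, hH.realApply_outAdjacency_mulSingle_self, htm]
    exact ha
  · rw [smul_mulSingle_pow_apply_of_ne hi]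
    refine (hH.realApply_outAdjacency_mulSingle_le_outDegree_mul a ht1 i).trans ?_
    gcongr
    exact hne i hi

theorem IsUniform.spectralRadius_outAdjacency_le (hH : H.IsUniform m)
    (hD : 0 ≤ D) (hDd : D ≤ d) (ha : H.outDegree a ≤ d) (hne : ∀ v ≠ a, H.outDegree v ≤ D) :
    (H.outAdjacency m).spectralRadius ≤ d ^ (1 / (m : ℝ)) * D ^ (1 - 1 / (m : ℝ)) := by
  have hexp : 0 ≤ 1 - 1 / (m : ℝ) := by
    rw [sub_nonneg, one_div]
    exact Nat.cast_inv_le_one m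
  have hcont : Continuous fun ε : ℝ =>
      (d + ε) ^ (1 / (m : ℝ)) * (D + ε) ^ (1 - 1 / (m : ℝ)) :=
    ((continuous_const_add d).rpow_const fun _ => Or.inr (by positivity)).mul
      ((continuous_const_add D).rpow_const fun _ => Or.inr hexp)
  have hlim := (hcont.tendsto 0).mono_left (nhdsWithin_le_nhds (s := Set.Ioi 0))
  simp only [add_zero] at hlim
  refine ge_of_tendsto hlim (eventually_mem_nhdsWithin.mono fun ε (hε : 0 < ε) => ?_)
  exact hH.spectralRadius_outAdjacency_le_of_pos (by positivity) (by gcongr)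
    (ha.trans (by linarith)) fun v hv => (hne v hv).trans (by linarith)

end DirectedHypergraph

end Bounds

section Enumeration

variable {V α : Type*} {n : ℕ} {v : Fin n ≃ V} {f : V → α}

theorem iInf_eq_apply_zero [ConditionallyCompleteLattice α] (hf : Monotone fun i => f (v i))
    (hn : 0 < n) : ⨅ u, f u = f (v ⟨0, hn⟩) := by
  refine IsLeast.csInf_eq ⟨⟨_, rfl⟩, Set.forall_mem_range.2 (v.surjective.forall.2 fun i => ?_)⟩
  exact hf (Fin.le_def.2 i.val.zero_le)

theorem iSup_eq_apply_sub_one [ConditionallyCompleteLattice α] (hf : Monotone fun i => f (v i))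
    (hn : 0 < n) : ⨆ u, f u = f (v ⟨n - 1, Nat.sub_one_lt_of_lt hn⟩) := by
  refine IsGreatest.csSup_eq ⟨⟨_, rfl⟩, Set.forall_mem_range.2 (v.surjective.forall.2 fun i => ?_)⟩
  exact hf (Fin.le_def.2 (Nat.le_sub_one_of_lt i.isLt))

theorem apply_one_le_of_ne_apply_zero [Preorder α] (hf : Monotone fun i => f (v i)) (hn : 1 < n)
    {u : V} (hu : u ≠ v ⟨0, Nat.zero_lt_of_lt hn⟩) : f (v ⟨1, hn⟩) ≤ f u := by
  obtain ⟨i, rfl⟩ := v.surjective u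
  have hi : (i : ℕ) ≠ 0 := fun hi => hu (congrArg v (Fin.ext hi))
  exact hf (Fin.le_def.2 (Nat.one_le_iff_ne_zero.2 hi))

theorem le_apply_sub_two_of_ne_apply_sub_one [Preorder α] (hf : Monotone fun i => f (v i))
    (hn : 0 < n) {u : V} (hu : u ≠ v ⟨n - 1, Nat.sub_one_lt_of_lt hn⟩) :
    f u ≤ f (v ⟨n - 2, Nat.sub_lt hn two_pos⟩) := by
  obtain ⟨i, rfl⟩ := v.surjective u
  have hi : (i : ℕ) ≠ n - 1 := fun hi => hu (congrArg v (Fin.ext hi))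
  exact hf (Fin.le_def.2 (show (i : ℕ) ≤ n - 2 by omega))

end Enumeration

theorem mainTheorem2 {V : Type*} [Fintype V] [DecidableEq V] (H : DirectedHypergraph V)
    (m : ℕ) [NeZero m] (hH : H.IsUniform m)
    (n : ℕ) (hn : 2 ≤ n) (v : Fin n ≃ V) (hd : Monotone fun i => H.outDegree (v i)) :
    IsGreatest (H.outAdjacency m).eigenvalueModuli (H.outAdjacency m).spectralRadius ∧
    (H.minOutDegree : ℝ) ^ (1 / (m : ℝ)) *
        (H.outDegree (v ⟨1, by omega⟩) : ℝ) ^ (1 - 1 / (m : ℝ)) ≤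
      (H.outAdjacency m).spectralRadius ∧
    (H.outAdjacency m).spectralRadius ≤
      (H.maxOutDegree : ℝ) ^ (1 / (m : ℝ)) *
        (H.outDegree (v ⟨n - 2, by omega⟩) : ℝ) ^ (1 - 1 / (m : ℝ)) := by
  have hn0 : 0 < n := by omega
  have : Nonempty V := ⟨v ⟨0, hn0⟩⟩
  rw [show H.minOutDegree = _ from iInf_eq_apply_zero hd hn0,
    show H.maxOutDegree = _ from iSup_eq_apply_sub_one hd hn0]
  refine ⟨hH.isGreatest_eigenvalueModuli_outAdjacency, ?_, ?_⟩
  · refine hH.le_spectralRadius_outAdjacency (Nat.cast_nonneg _) ?_ le_rfl fun u hu => ?_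
    · exact_mod_cast hd (Fin.le_def.2 (Nat.zero_le 1))
    · exact_mod_cast apply_one_le_of_ne_apply_zero hd hn hu
  · refine hH.spectralRadius_outAdjacency_le (Nat.cast_nonneg _) ?_ le_rfl fun u hu => ?_
    · exact_mod_cast hd (Fin.le_def.2 (show n - 2 ≤ n - 1 by omega))
    · exact_mod_cast le_apply_sub_two_of_ne_apply_sub_one hd hn0 hu
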